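/- A 2-dimensional vector addition system (2-VAS) is a finite set $\mathcal V\subseteq\mathbb Z^2$; put $\|\mathcal V\|=2\sum_{v\in\mathcal V}\|v\|_\infty$. A vector $t\in\mathbb N^2$ is reachable in $\mathcal V$ if there is a finite sequence $v_1,\dots,v_n$ of elements of $\mathcal V$ (repetitions allowed, $n\ge 0$) with $v_1+\dots+v_n=t$ all of whose partial sums $v_1+\dots+v_i$, $0\le i\le n$, lie in $\mathbb N^2$; it is box-reachable in $\mathcal V$ if the sequence can be chosen so that, in addition, $v_1+\dots+v_i\le t$ in both coordinates for all $1\le i\le n$. Let $\mathrm{Reach}(\mathcal V)$ and $\mathrm{BoxReach}(\mathcal V)$ denote the sets of reachable and of box-reachable vectors. Theorem. There are a computable function $W$ that maps each 2-VAS $\mathcal V$ (given as a list of its vectors) to a number $W(\mathcal V)\in\mathbb N$, and a polynomial $p$ with coefficients in $\mathbb N$, such that for every 2-VAS $\mathcal V$ we have $W(\mathcal V)\le p(\|\mathcal V\|)$ and $$\mathrm{BoxReach}(\mathcal V)\cap[W(\mathcal V),\infty)^2=\mathrm{Reach}(\mathcal V)\cap[W(\mathcal V),\infty)^2 .$$ 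-/

import Mathlib

/-- A vector addition system of dimension `d`: a finite set of integer vectors. -/
abbrev VAS (d : ℕ) := Finset (Fin d → ℤ)

namespace VAS

variable {d : ℕ}

/-- The infinity norm of an integer vector. -/
def vecNorm (u : Fin d → ℤ) : ℕ := Finset.univ.sup fun k => (u k).natAbs

/-- The norm of a VAS: `d` times the sum of the infinity norms of its vectors. -/
def norm (V : VAS d) : ℕ := d * ∑ v ∈ V, vecNorm v

/-- A path of `V` is a finite sequence of vectors of `V`. -/
def IsPath (V : VAS d) (π : List (Fin d → ℤ)) : Prop := ∀ v ∈ π, v ∈ V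

/-- The effect of a finite sequence of vectors: its sum. -/
def eff (π : List (Fin d → ℤ)) : Fin d → ℤ := π.sum

/-- The inclusion of `ℕ^d` into `ℤ^d`. -/
def toInt (t : Fin d → ℕ) : Fin d → ℤ := fun k => (t k : ℤ)

/-- The trace of `π` from `s` ends in `t`, and every vector of the trace (including the first
and the last one) is nonnegative. -/
def NRun (s : Fin d → ℤ) (π : List (Fin d → ℤ)) (t : Fin d → ℤ) : Prop :=
  s + eff π = t ∧ ∀ i ≤ π.length, 0 ≤ s + eff (π.take i)

/-- The reachability set of `V` (from the zero vector). -/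
def reach (V : VAS d) : Set (Fin d → ℕ) :=
  {t | ∃ π, IsPath V π ∧ NRun 0 π (toInt t)}

/-- The box-reachability set of `V`: the targets `t` that are reached from the zero vector by a
path whose whole trace stays nonnegative and below `t` in every coordinate. -/
def boxReach (V : VAS d) : Set (Fin d → ℕ) :=
  {t | ∃ π, IsPath V π ∧ NRun 0 π (toInt t) ∧
    ∀ i, 1 ≤ i → i ≤ π.length → eff (π.take i) ≤ toInt t}

/-- The vectors of `ℕ^d` all of whose coordinates are at least `W`. -/
def deep (d W : ℕ) : Set (Fin d → ℕ) := {t | ∀ k, W ≤ t k}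

/-- A function from VAS to natural numbers is effectively computable if some algorithm computes
it from any list that enumerates the vectors of the given VAS (in any order, possibly with
repetitions). -/
def EffectivelyComputable (W : VAS d → ℕ) : Prop :=
  Computable fun l : List (Fin d → ℤ) => W l.toFinset

end VAS

/-!
Let `V` be a planar vector addition system whose vectors have norm at most `M`. A path reaching
`t ≠ 0` is a nonnegative integer combination of `V` with sum `t`, and its first nonzero step `u` is a
nonnegative vector (`exists_nonneg_of_nRun`). These two facts already make every sufficiently deep
`t` box-reachable.

A combination with nonnegative sum `r` can be interleaved proportionally, so that the trace follows
the segment from `0` to `r` within a distance polynomial in `M` (`exists_path_staysIn`). What remains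
is to keep the two ends of the path inside the box. For this it suffices to have many copies of a
pair `u`, `v`, where `u` is nonnegative and in each coordinate one of the two is positive: `u^A v^B`
moves away from both axes, the reversed word `v^B u^A` approaches `t` in the same way, and the rest
is interleaved in between (`mem_boxReach_of_launch`).

To find such a pair, consider the vectors that occur at least `K` times in the combination. The
others contribute little, so the sum of the frequent ones is still positive. Hence
(`launches_or_spanning`) either a suitable pair is already frequent, or there are frequent vectors
`a` with signs `(+, -)` and `b` with signs `(-, +)` whose cone contains the quadrant. In the latter
case `det (a, b) • u = det (u, b) • a + det (a, u) • b`, and exchanging copies of `a` and `b` for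
copies of `u` yields another combination for `t` in which `u` is frequent; `a` or `b` then serves as
its partner (`mem_boxReach_of_combination`). All the quantities are polynomial in `M`, which gives
the threshold.
-/

namespace VAS

variable {d : ℕ}

/-! ### Traces that stay in a region -/

lemma eff_append (π ρ : List (Fin d → ℤ)) : eff (π ++ ρ) = eff π + eff ρ := List.sum_append

lemma eff_replicate (n : ℕ) (v : Fin d → ℤ) : eff (List.replicate n v) = n • v :=
  List.sum_replicate n v

lemma nsmul_apply_eq (n : ℕ) (v : Fin d → ℤ) (k : Fin d) : (n • v) k = n * v k := by
  rw [Pi.smul_apply, nsmul_eq_mul]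

/-- The trace of `π` from `s` stays inside the region `S`. -/
def StaysIn (S : Set (Fin d → ℤ)) (s : Fin d → ℤ) (π : List (Fin d → ℤ)) : Prop :=
  ∀ i ≤ π.length, s + eff (π.take i) ∈ S

lemma StaysIn.mono {S T : Set (Fin d → ℤ)} (h : S ⊆ T) {s : Fin d → ℤ} {π : List (Fin d → ℤ)}
    (hπ : StaysIn S s π) : StaysIn T s π := fun i hi => h (hπ i hi)

lemma StaysIn.append {S : Set (Fin d → ℤ)} {s : Fin d → ℤ} {π ρ : List (Fin d → ℤ)}
    (hπ : StaysIn S s π) (hρ : StaysIn S (s + eff π) ρ) : StaysIn S s (π ++ ρ) := by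
  intro i hi
  rw [List.take_append, eff_append]
  rcases le_total i π.length with h | h
  · simpa [Nat.sub_eq_zero_of_le h, eff] using hπ i h
  · rw [List.take_of_length_le h, ← add_assoc]
    exact hρ _ (by rw [List.length_append] at hi; omega)

lemma StaysIn.translate {lo hi s : Fin d → ℤ} {π : List (Fin d → ℤ)}
    (h : StaysIn (Set.Icc lo hi) 0 π) : StaysIn (Set.Icc (s + lo) (s + hi)) s π := by
  intro i hi
  have := h i hi
  rw [zero_add] at this
  exact ⟨add_le_add le_rfl this.1, add_le_add le_rfl this.2⟩

/-- Boxes are convex, so repeating one vector stays in a box that contains both endpoints. -/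
lemma staysIn_replicate {lo hi s v : Fin d → ℤ} {n : ℕ} (h₀ : s ∈ Set.Icc lo hi)
    (h₁ : s + n • v ∈ Set.Icc lo hi) :
    StaysIn (Set.Icc lo hi) s (List.replicate n v) := by
  intro i hi'
  rw [List.length_replicate] at hi'
  rw [List.take_replicate, min_eq_left hi', eff_replicate]
  have hin : (i : ℤ) ≤ n := by exact_mod_cast hi'
  have hi0 : (0 : ℤ) ≤ i := by positivity
  refine ⟨fun k => ?_, fun k => ?_⟩
  · have a := h₀.1 k
    have b := h₁.1 k
    simp only [Pi.add_apply, nsmul_apply_eq] at b ⊢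
    rcases le_total 0 (v k) with h | h <;> nlinarith
  · have a := h₀.2 k
    have b := h₁.2 k
    simp only [Pi.add_apply, nsmul_apply_eq] at b ⊢
    rcases le_total 0 (v k) with h | h <;> nlinarith

lemma abs_apply_le_vecNorm (v : Fin d → ℤ) (k : Fin d) : |v k| ≤ vecNorm v := by
  rw [Int.abs_eq_natAbs]
  exact_mod_cast Finset.le_sup (f := fun k => (v k).natAbs) (Finset.mem_univ k)

lemma abs_eff_le {M : ℕ} {π : List (Fin d → ℤ)} (h : ∀ v ∈ π, vecNorm v ≤ M) (k : Fin d) :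
    |eff π k| ≤ π.length * M := by
  induction π with
  | nil => simp [eff]
  | cons v π ih =>
    have h1 := ih fun w hw => h w (List.mem_cons_of_mem _ hw)
    have h2 : |v k| ≤ M :=
      (abs_apply_le_vecNorm v k).trans (by exact_mod_cast h v List.mem_cons_self)
    have h3 : eff (v :: π) k = v k + eff π k := by simp [eff]
    rw [h3, List.length_cons]
    push_cast
    linarith [abs_add_le (v k) (eff π k)]

lemma staysIn_of_length_le {M L : ℕ} {lo hi s : Fin d → ℤ} {π : List (Fin d → ℤ)}
    (h : ∀ v ∈ π, vecNorm v ≤ M) (hL : π.length ≤ L) (hs : s ∈ Set.Icc lo hi) :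
    StaysIn (Set.Icc (lo - fun _ => (L * M : ℤ)) (hi + fun _ => (L * M : ℤ))) s π := by
  intro i hi'
  have key : ∀ k, |eff (π.take i) k| ≤ (L * M : ℤ) := fun k => by
    refine (abs_eff_le (fun v hv => h v (List.mem_of_mem_take hv)) k).trans ?_
    have : (π.take i).length ≤ L := (List.length_take_le' i π).trans hL
    gcongr
  refine ⟨fun k => ?_, fun k => ?_⟩
  · have a := hs.1 k
    have b := (abs_le.1 (key k)).1
    simp only [Pi.add_apply, Pi.sub_apply]
    linarith
  · have a := hs.2 k
    have b := (abs_le.1 (key k)).2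
    simp only [Pi.add_apply]
    linarith

/-! ### Interleaving along a segment -/

/-- Every choice of multiplicities is realised by a path, in some arbitrary order. -/
lemma exists_path_of_count (V : VAS d) (c : (Fin d → ℤ) → ℕ) :
    ∃ π, IsPath V π ∧ eff π = ∑ v ∈ V, c v • v ∧ π.length = ∑ v ∈ V, c v := by
  induction V using Finset.induction_on with
  | empty => exact ⟨[], by simp [IsPath], by simp [eff], by simp⟩
  | insert a V ha ih =>
    obtain ⟨π, h1, h2, h3⟩ := ih
    refine ⟨List.replicate (c a) a ++ π, ?_, ?_, ?_⟩
    · intro v hv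
      rcases List.mem_append.1 hv with hv | hv
      · rw [List.eq_of_mem_replicate hv]
        exact Finset.mem_insert_self _ _
      · exact Finset.mem_insert_of_mem (h1 v hv)
    · rw [eff_append, eff_replicate, h2, Finset.sum_insert ha]
    · rw [List.length_append, List.length_replicate, h3, Finset.sum_insert ha]

/-- If every `v` is used `⌊m v * i / n⌋` times, the sum is close to the point `(i / n) • r` of the
segment from `0` to `r = ∑ v ∈ V, m v • v`: rounding costs at most one copy of each vector. -/
lemma interleave_sum_mem (V : VAS d) {M : ℕ} (hM : ∀ v ∈ V, vecNorm v ≤ M)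
    (m : (Fin d → ℤ) → ℕ) (hr : 0 ≤ ∑ v ∈ V, m v • v) {n i : ℕ} (hn : 0 < n) (hi : i ≤ n) :
    ∑ v ∈ V, (m v * i / n) • v ∈ Set.Icc (0 - fun _ => (V.card * M : ℤ))
      ((∑ v ∈ V, m v • v) + fun _ => (V.card * M : ℤ)) := by
  have hn' : (0 : ℤ) < n := by exact_mod_cast hn
  have hin : (i : ℤ) ≤ n := by exact_mod_cast hi
  have hi0 : (0 : ℤ) ≤ i := by positivity
  have key : ∀ k, |(n : ℤ) * (∑ v ∈ V, (m v * i / n) • v) k - i * (∑ v ∈ V, m v • v) k|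
      ≤ n * (V.card * M) := fun k => by
    have e : (n : ℤ) * (∑ v ∈ V, (m v * i / n) • v) k - i * (∑ v ∈ V, m v • v) k
        = ∑ v ∈ V, (-((m v * i % n : ℕ) : ℤ) * v k) := by
      simp only [Finset.sum_apply, nsmul_apply_eq, Finset.mul_sum,
        ← Finset.sum_sub_distrib]
      refine Finset.sum_congr rfl fun v _ => ?_
      have h : (n : ℤ) * ((m v * i / n : ℕ) : ℤ) + ((m v * i % n : ℕ) : ℤ) = m v * i := by
        exact_mod_cast Nat.div_add_mod (m v * i) n
      linear_combination (v k) * h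
    rw [e]
    refine (Finset.abs_sum_le_sum_abs _ _).trans ?_
    have : ∀ v ∈ V, |(-((m v * i % n : ℕ) : ℤ) * v k)| ≤ n * M := fun v hv => by
      rw [abs_mul, abs_neg, Nat.abs_cast]
      have h1 : ((m v * i % n : ℕ) : ℤ) ≤ n := by exact_mod_cast (Nat.mod_lt _ hn).le
      have h2 : |v k| ≤ M := (abs_apply_le_vecNorm v k).trans (by exact_mod_cast hM v hv)
      exact mul_le_mul h1 h2 (abs_nonneg _) hn'.le
    refine (Finset.sum_le_sum this).trans (le_of_eq ?_)
    rw [Finset.sum_const, nsmul_eq_mul]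
    ring
  refine ⟨fun k => ?_, fun k => ?_⟩
  · have a := (abs_le.1 (key k)).1
    have b : (0 : ℤ) ≤ (∑ v ∈ V, m v • v) k := hr k
    rw [Pi.sub_apply, Pi.zero_apply]
    have := mul_nonneg hi0 b
    refine le_of_mul_le_mul_left ?_ hn'
    linarith
  · have a := (abs_le.1 (key k)).2
    have b : (0 : ℤ) ≤ (∑ v ∈ V, m v • v) k := hr k
    rw [Pi.add_apply]
    have := mul_le_mul_of_nonneg_right hin b
    refine le_of_mul_le_mul_left ?_ hn'
    linarith

/-- Proportional interleaving: a combination of vectors of `V` with nonnegative sum `r` can be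
ordered so that its trace leaves the box from `0` to `r` by at most `2 * V.card * M`. At stage `i`
of `n` the path has used `⌊m v * i / n⌋` copies of each `v`; since `m v ≤ n`, every stage adds at
most one copy of each vector, so the trace moves little between two stages. -/
lemma exists_path_staysIn (V : VAS d) {M : ℕ} (hM : ∀ v ∈ V, vecNorm v ≤ M)
    (m : (Fin d → ℤ) → ℕ) (hr : 0 ≤ ∑ v ∈ V, m v • v) :
    ∃ π, IsPath V π ∧ eff π = ∑ v ∈ V, m v • v ∧
      StaysIn (Set.Icc (fun _ => -(2 * V.card * M : ℤ))
        ((∑ v ∈ V, m v • v) + fun _ => (2 * V.card * M : ℤ))) 0 π := by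
  set r := ∑ v ∈ V, m v • v with hrdef
  set n := ∑ v ∈ V, m v + 1 with hn
  have hn0 : 0 < n := by omega
  have hmn : ∀ v ∈ V, m v ≤ n := fun v hv =>
    (Finset.single_le_sum (f := m) (fun _ _ => Nat.zero_le _) hv).trans (by omega)
  have main : ∀ i ≤ n, ∃ π, IsPath V π ∧ eff π = ∑ v ∈ V, (m v * i / n) • v ∧
      StaysIn (Set.Icc (fun _ => -(2 * V.card * M : ℤ))
        (r + fun _ => (2 * V.card * M : ℤ))) 0 π := by
    intro i
    induction i with
    | zero =>
      refine fun _ => ⟨[], by simp [IsPath], by simp [eff], fun i _ => ⟨fun k => ?_, fun k => ?_⟩⟩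
      · have : (0 : ℤ) ≤ 2 * V.card * M := by positivity
        simpa [eff] using this
      · have : (0 : ℤ) ≤ 2 * V.card * M := by positivity
        have h := hr k
        simp only [Pi.zero_apply] at h
        simp only [eff, List.take_nil, List.sum_nil, Pi.add_apply, Pi.zero_apply]
        linarith
    | succ i ih =>
      intro hi
      obtain ⟨π, h1, h2, h3⟩ := ih (by omega)
      have step : ∀ v, m v * i / n ≤ m v * (i + 1) / n := fun v =>
        Nat.div_le_div_right (Nat.mul_le_mul_left _ (Nat.le_succ i))
      obtain ⟨ρ, g1, g2, g3⟩ :=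
        exists_path_of_count V fun v => m v * (i + 1) / n - m v * i / n
      have len : ρ.length ≤ V.card := by
        rw [g3, Finset.card_eq_sum_ones]
        refine Finset.sum_le_sum fun v hv => ?_
        have : m v * (i + 1) / n ≤ m v * i / n + 1 := by
          rw [← Nat.add_div_right _ hn0]
          exact Nat.div_le_div_right (by rw [mul_add, mul_one]; have := hmn v hv; omega)
        omega
      refine ⟨π ++ ρ, fun v hv => (List.mem_append.1 hv).elim (h1 v) (g1 v), ?_,
        h3.append ?_⟩
      · rw [eff_append, h2, g2, ← Finset.sum_add_distrib]
        refine Finset.sum_congr rfl fun v _ => ?_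
        rw [← add_smul, Nat.add_sub_cancel' (step v)]
      · rw [zero_add, h2]
        refine (staysIn_of_length_le (fun v hv => hM v (g1 v hv)) len
          (interleave_sum_mem V hM m hr hn0 (by omega : i ≤ n))).mono ?_
        refine Set.Icc_subset_Icc (fun k => ?_) (fun k => ?_)
        · simp only [Pi.sub_apply, Pi.zero_apply]
          linarith
        · simp only [Pi.add_apply, ← hrdef]
          linarith
  obtain ⟨π, h1, h2, h3⟩ := main n le_rfl
  refine ⟨π, h1, ?_, h3⟩
  rw [h2]
  exact Finset.sum_congr rfl fun v _ => by rw [Nat.mul_div_cancel _ hn0]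

/-! ### Launching from the origin and landing at the target -/

/-- The path `u^A v^B ρ v^B u^A` lies in the box: its first part moves away from the axes by the
width of the margin that the interleaved path `ρ` needs, and its last part is the mirror image of the
first under `x ↦ t - x`. -/
lemma mem_boxReach_of_launch (V : VAS d) {M : ℕ} (hM : ∀ v ∈ V, vecNorm v ≤ M)
    (m : (Fin d → ℤ) → ℕ) {u v : Fin d → ℤ} (hu : u ∈ V) (hv : v ∈ V) (hu0 : 0 ≤ u) {A B : ℕ}
    (hs : (fun _ => (2 * V.card * M : ℤ)) ≤ A • u + B • v)
    (hr : 0 ≤ ∑ v ∈ V, m v • v) {t : Fin d → ℕ}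
    (ht : toInt t = (∑ v ∈ V, m v • v) + 2 • (A • u + B • v)) (hAt : A • u ≤ toInt t) :
    t ∈ boxReach V := by
  set r := ∑ v ∈ V, m v • v with hrdef
  obtain ⟨ρ, h1, h2, h3⟩ := exists_path_staysIn V hM m hr
  rw [← hrdef] at h2 h3
  have hC : (0 : Fin d → ℤ) ≤ fun _ => (2 * V.card * M : ℤ) := fun k => by
    simp only [Pi.zero_apply]
    positivity
  set C : Fin d → ℤ := fun _ => (2 * V.card * M : ℤ) with hCdef
  have hAu : 0 ≤ A • u := nsmul_nonneg hu0 A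
  set a := A • u with ha
  set b := B • v with hb
  have hs0 : 0 ≤ a + b := hC.trans hs
  have ht0 : 0 ≤ toInt t := hAu.trans hAt
  have hab : a + b ≤ toInt t := by
    rw [ht, two_smul]
    exact le_add_of_nonneg_of_le hr (le_add_of_nonneg_right hs0)
  have hra : r + (a + b) + b + a = toInt t := by rw [ht, two_smul]; abel
  set π := (((List.replicate A u ++ List.replicate B v) ++ ρ) ++ List.replicate B v) ++
    List.replicate A u with hπ
  have e1 : eff (List.replicate A u ++ List.replicate B v) = a + b := by
    rw [eff_append, eff_replicate, eff_replicate]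
  have e2 : eff ((List.replicate A u ++ List.replicate B v) ++ ρ) = r + (a + b) := by
    rw [eff_append, e1, h2, add_comm]
  have e3 : eff (((List.replicate A u ++ List.replicate B v) ++ ρ) ++ List.replicate B v)
      = r + (a + b) + b := by
    rw [eff_append, e2, eff_replicate]
  have e4 : eff π = toInt t := by rw [hπ, eff_append, e3, eff_replicate, ← hra]
  have m0 : (0 : Fin d → ℤ) ∈ Set.Icc 0 (toInt t) := ⟨le_rfl, ht0⟩
  have m1 : a ∈ Set.Icc 0 (toInt t) := ⟨hAu, hAt⟩
  have m2 : a + b ∈ Set.Icc 0 (toInt t) := ⟨hs0, hab⟩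
  have m3 : r + (a + b) ∈ Set.Icc 0 (toInt t) :=
    ⟨add_nonneg hr hs0, by
      rw [← hra, add_assoc _ b a, add_comm b a]
      exact le_add_of_nonneg_right hs0⟩
  have m4 : r + (a + b) + b ∈ Set.Icc 0 (toInt t) := by
    have e : r + (a + b) + b = toInt t - a := by rw [← hra]; abel
    rw [e]
    exact ⟨sub_nonneg.2 hAt, sub_le_self _ hAu⟩
  have m5 : r + (a + b) + b + a ∈ Set.Icc 0 (toInt t) := by
    rw [hra]
    exact ⟨ht0, le_rfl⟩
  have stay : StaysIn (Set.Icc 0 (toInt t)) 0 π := by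
    refine StaysIn.append (StaysIn.append (StaysIn.append (StaysIn.append ?_ ?_) ?_) ?_) ?_
    · exact staysIn_replicate m0 (by rwa [zero_add])
    · rw [eff_replicate, zero_add]
      exact staysIn_replicate m1 m2
    · rw [e1, zero_add]
      refine (h3.translate (s := a + b)).mono (Set.Icc_subset_Icc (fun k => ?_) ?_)
      · have := hs k
        simp only [hCdef] at this
        rw [Pi.add_apply, Pi.zero_apply]
        linarith
      · rw [ht, two_smul, add_left_comm]
        exact add_le_add le_rfl (add_le_add le_rfl hs)
    · rw [e2, zero_add]
      exact staysIn_replicate m3 m4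
    · rw [e3, zero_add]
      exact staysIn_replicate m4 m5
  refine ⟨π, ?_, ⟨by rw [zero_add, e4], fun i hi => (stay i hi).1⟩, fun i _ hi => ?_⟩
  · intro w hw
    simp only [hπ, List.mem_append, List.mem_replicate] at hw
    rcases hw with (((⟨-, rfl⟩ | ⟨-, rfl⟩) | hw) | ⟨-, rfl⟩) | ⟨-, rfl⟩
    exacts [hu, hv, h1 w hw, hv, hu]
  · simpa using (stay i hi).2

/-! ### Runs and their multiplicities -/

/-- The first nonzero step of a run from the origin has no negative coordinate. -/
lemma exists_nonneg_of_nRun {π : List (Fin d → ℤ)} {t : Fin d → ℤ} (h : NRun 0 π t)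
    (ht : t ≠ 0) : ∃ u ∈ π, 0 ≤ u ∧ u ≠ 0 := by
  induction π with
  | nil => exact absurd (by simpa [NRun, eff] using h.1.symm) ht
  | cons v π ih =>
    by_cases hv : v = 0
    · subst hv
      obtain ⟨u, hu, hu'⟩ := ih ⟨by simpa [eff] using h.1, fun i hi => by
        simpa [eff] using h.2 (i + 1) (by simpa using hi)⟩
      exact ⟨u, List.mem_cons_of_mem _ hu, hu'⟩
    · exact ⟨v, List.mem_cons_self, by simpa [eff] using h.2 1 (by simp), hv⟩

lemma eff_eq_sum_count {V : VAS d} {π : List (Fin d → ℤ)} (h : IsPath V π) :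
    eff π = ∑ v ∈ V, π.count v • v :=
  Finset.sum_list_count_of_subset π V fun v hv => h v (List.mem_toFinset.1 hv)

lemma card_le_of_vecNorm_le {V : VAS 2} {M : ℕ} (hM : ∀ v ∈ V, vecNorm v ≤ M) :
    V.card ≤ (2 * M + 1) ^ 2 := by
  have hsub : V ⊆ Fintype.piFinset fun _ : Fin 2 => Finset.Icc (-(M : ℤ)) M := fun v hv =>
    Fintype.mem_piFinset.2 fun k => Finset.mem_Icc.2 <| abs_le.1 <|
      (abs_apply_le_vecNorm v k).trans (by exact_mod_cast hM v hv)
  refine (Finset.card_le_card hsub).trans (le_of_eq ?_)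
  rw [Fintype.card_piFinset_const, Int.card_Icc]
  congr 1
  omega

/-! ### Launching pairs -/

/-- The pair `(u, v)` launches if many copies of `u` followed by suitably fewer copies of `v` form
a run from `0` to a vector all of whose coordinates are large. The case `u = v` is allowed, and then
all coordinates of `u` are positive. -/
def Launches (u v : Fin d → ℤ) : Prop := 0 ≤ u ∧ ∀ k, 0 < u k ∨ 0 < v k

lemma Launches.le_add {u v : Fin d → ℤ} (h : Launches u v) {M A B C : ℕ} (hv : vecNorm v ≤ M)
    (hB : C ≤ B) (hA : C + B * M ≤ A) : (fun _ => (C : ℤ)) ≤ A • u + B • v := by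
  intro k
  simp only [Pi.add_apply, nsmul_apply_eq]
  have h0 : 0 ≤ u k := h.1 k
  have hA' : (C : ℤ) + B * M ≤ A := by exact_mod_cast hA
  have hB' : (C : ℤ) ≤ B := by exact_mod_cast hB
  have hv' := (abs_le.1 ((abs_apply_le_vecNorm v k).trans
    (show ((vecNorm v : ℕ) : ℤ) ≤ M by exact_mod_cast hv))).1
  have hB0 : (0 : ℤ) ≤ B := by positivity
  have hA0 : (0 : ℤ) ≤ A := by positivity
  rcases lt_or_ge 0 (u k) with hu | hu
  · have h1 : (A : ℤ) * 1 ≤ A * u k := mul_le_mul_of_nonneg_left (by omega) hA0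
    have h2 : (B : ℤ) * -M ≤ B * v k := mul_le_mul_of_nonneg_left hv' hB0
    linarith
  · have hvk : 0 < v k := (h.2 k).resolve_left (not_lt.2 hu)
    have h1 : (B : ℤ) * 1 ≤ B * v k := mul_le_mul_of_nonneg_left (by omega) hB0
    have h2 : (0 : ℤ) ≤ A * u k := mul_nonneg hA0 h0
    linarith

/-- If a deep `t` is a combination of vectors of `V` that contains enough copies of a launching pair
for both ends of the path, then `t` is box-reachable. -/
lemma mem_boxReach_of_launches {V : VAS d} {M : ℕ} (hM : ∀ w ∈ V, vecNorm w ≤ M)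
    (m : (Fin d → ℤ) → ℕ) {u v : Fin d → ℤ} (hu : u ∈ V) (hv : v ∈ V) (h : Launches u v)
    {A B : ℕ} (hB : 2 * V.card * M ≤ B) (hA : 2 * V.card * M + B * M ≤ A) {t : Fin d → ℕ}
    (ht : toInt t = (∑ w ∈ V, m w • w) + 2 • (A • u + B • v))
    (hdeep : ∀ k, 2 * (A + B) * M ≤ t k) : t ∈ boxReach V := by
  have hs : (fun _ => (2 * V.card * M : ℤ)) ≤ A • u + B • v := by
    have := h.le_add (hM v hv) hB hA
    push_cast at this
    exact this
  have hb : ∀ k, (A : ℤ) * u k ≤ A * M ∧ (B : ℤ) * v k ≤ B * M := fun k => by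
    have h1 := (le_abs_self _).trans (abs_apply_le_vecNorm u k)
    have h2 := (le_abs_self _).trans (abs_apply_le_vecNorm v k)
    have h3 : ((vecNorm u : ℕ) : ℤ) ≤ M := by exact_mod_cast hM u hu
    have h4 : ((vecNorm v : ℕ) : ℤ) ≤ M := by exact_mod_cast hM v hv
    exact ⟨mul_le_mul_of_nonneg_left (h1.trans h3) (by positivity),
      mul_le_mul_of_nonneg_left (h2.trans h4) (by positivity)⟩
  have ht' : ∀ k, (2 * (A + B) * M : ℤ) ≤ toInt t k := fun k => by
    have := hdeep k
    simp only [toInt]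
    exact_mod_cast this
  refine mem_boxReach_of_launch V hM m hu hv h.1 hs ?_ ht ?_
  · intro k
    have e := congrFun ht k
    simp only [Pi.add_apply, nsmul_apply_eq, Nat.cast_ofNat] at e
    have := ht' k
    have := hb k
    rw [Pi.zero_apply]
    linarith
  · intro k
    rw [nsmul_apply_eq]
    have := ht' k
    have := hb k
    have : (0 : ℤ) ≤ A * M := by positivity
    have : (0 : ℤ) ≤ B * M := by positivity
    linarith

/-! ### Frequent vectors in the plane -/

/-- The vectors that a combination uses rarely contribute little, so the frequently used ones
alone still have a positive sum. -/
lemma sum_frequent_pos {V : VAS d} {M K : ℕ} (hM : ∀ w ∈ V, vecNorm w ≤ M)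
    (m : (Fin d → ℤ) → ℕ) {k : Fin d} (h : (V.card * K * M : ℤ) < (∑ w ∈ V, m w • w) k) :
    0 < ∑ w ∈ V with K ≤ m w, (m w : ℤ) * w k := by
  have e : (∑ w ∈ V, m w • w) k = ∑ w ∈ V, (m w : ℤ) * w k := by
    rw [Finset.sum_apply]
    exact Finset.sum_congr rfl fun w _ => nsmul_apply_eq _ _ _
  rw [e, ← Finset.sum_filter_add_sum_filter_not V (fun w => K ≤ m w)] at h
  have small : ∑ w ∈ V with ¬ K ≤ m w, (m w : ℤ) * w k ≤ V.card * K * M := by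
    have hc : ((V.filter fun w => ¬ K ≤ m w).card : ℤ) ≤ V.card := by
      exact_mod_cast Finset.card_filter_le _ _
    calc ∑ w ∈ V with ¬ K ≤ m w, (m w : ℤ) * w k
        ≤ ∑ w ∈ V with ¬ K ≤ m w, (K * M : ℤ) := by
          refine Finset.sum_le_sum fun w hw => ?_
          rw [Finset.mem_filter, not_le] at hw
          have h1 := (le_abs_self _).trans (abs_apply_le_vecNorm w k)
          have h2 : ((vecNorm w : ℕ) : ℤ) ≤ M := by exact_mod_cast hM w hw.1
          have h3 : (m w : ℤ) ≤ K := by exact_mod_cast hw.2.le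
          exact (mul_le_mul_of_nonneg_left (h1.trans h2) (by positivity)).trans
            (mul_le_mul_of_nonneg_right h3 (by positivity))
      _ = (V.filter fun w => ¬ K ≤ m w).card * (K * M : ℤ) := by
          rw [Finset.sum_const, nsmul_eq_mul]
      _ ≤ V.card * (K * M : ℤ) := mul_le_mul_of_nonneg_right hc (by positivity)
      _ = V.card * K * M := by ring
  linarith

/-- A planar alternative: if a combination of vectors of `S` is positive, then `S` contains a
launching pair or two vectors `a` and `b`, in the open fourth and second quadrants, whose cone has
the nonzero nonnegative vectors in its interior. -/
lemma launches_or_spanning {S : Finset (Fin 2 → ℤ)} {m : (Fin 2 → ℤ) → ℕ}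
    (h : ∀ k, 0 < ∑ w ∈ S, (m w : ℤ) * w k) :
    (∃ u ∈ S, ∃ v ∈ S, Launches u v) ∨
      ∃ a ∈ S, ∃ b ∈ S, 0 < a 0 ∧ a 1 < 0 ∧ b 0 < 0 ∧ 0 < b 1 ∧ 0 < a 0 * b 1 - a 1 * b 0 := by
  by_contra! hcon
  obtain ⟨hL, hD⟩ := hcon
  have hpos : ∀ k, ∃ w ∈ S, 0 < w k := fun k => by
    obtain ⟨w, hw, hw'⟩ := Finset.exists_lt_of_sum_lt (s := S) (f := fun _ => (0 : ℤ))
      (g := fun w => (m w : ℤ) * w k) (by simpa using h k)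
    exact ⟨w, hw, pos_of_mul_pos_right hw' (by positivity)⟩
  obtain ⟨x, hx, hx0⟩ := hpos 0
  obtain ⟨y, hy, hy1⟩ := hpos 1
  have hX : ∀ w ∈ S, 0 < w 0 → w 1 < 0 := fun w hw hw0 => by
    by_contra! hw1
    exact hL w hw y hy ⟨Fin.forall_fin_two.2 ⟨hw0.le, hw1⟩,
      Fin.forall_fin_two.2 ⟨Or.inl hw0, Or.inr hy1⟩⟩
  have hY : ∀ w ∈ S, 0 < w 1 → w 0 < 0 := fun w hw hw1 => by
    by_contra! hw0
    exact hL w hw x hx ⟨Fin.forall_fin_two.2 ⟨hw0, hw1.le⟩,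
      Fin.forall_fin_two.2 ⟨Or.inr hx0, Or.inl hw1⟩⟩
  -- Among the vectors pointing right and down, `a` is the one of least slope in absolute value.
  obtain ⟨a, ha, hamax⟩ := Finset.exists_max_image (S.filter fun w => 0 < w 0)
    (fun w => (w 1 : ℚ) / w 0) ⟨x, Finset.mem_filter.2 ⟨hx, hx0⟩⟩
  rw [Finset.mem_filter] at ha
  have ha1 := hX a ha.1 ha.2
  -- No vector of `S` lies on the counterclockwise side of `a`, but their positive sum does.
  have hdet : ∀ w ∈ S, a 0 * w 1 - a 1 * w 0 ≤ 0 := fun w hw => by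
    rcases lt_or_ge 0 (w 0) with hw0 | hw0
    · have := hamax w (Finset.mem_filter.2 ⟨hw, hw0⟩)
      rw [div_le_div_iff₀ (by exact_mod_cast hw0) (by exact_mod_cast ha.2)] at this
      have : w 1 * a 0 ≤ a 1 * w 0 := by exact_mod_cast this
      linarith
    · rcases lt_or_ge 0 (w 1) with hw1 | hw1
      · exact hD a ha.1 w hw ha.2 ha1 (hY w hw hw1) hw1
      -- Vectors without a positive coordinate lie clockwise of `a` as well.
      · nlinarith [ha.2]
  have hsum : a 0 * ∑ w ∈ S, (m w : ℤ) * w 1 - a 1 * ∑ w ∈ S, (m w : ℤ) * w 0 ≤ 0 := by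
    rw [Finset.mul_sum, Finset.mul_sum, ← Finset.sum_sub_distrib]
    refine Finset.sum_nonpos fun w hw => ?_
    have := mul_nonpos_of_nonneg_of_nonpos (by positivity : (0 : ℤ) ≤ m w) (hdet w hw)
    linarith
  nlinarith [h 0, h 1, mul_pos ha.2 (h 1), mul_pos (neg_pos.2 ha1) (h 0)]

lemma sum_single_smul {V : VAS d} {w : Fin d → ℤ} (hw : w ∈ V) (n : ℕ) :
    ∑ v ∈ V, (Pi.single w n : (Fin d → ℤ) → ℕ) v • v = n • w := by
  simp [Pi.single_apply, ite_smul, hw]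

lemma sum_sub_smul (V : VAS d) {m g : (Fin d → ℤ) → ℕ} (h : g ≤ m) :
    ∑ v ∈ V, (m - g) v • v = ∑ v ∈ V, m v • v - ∑ v ∈ V, g v • v := by
  rw [eq_sub_iff_add_eq, ← Finset.sum_add_distrib]
  refine Finset.sum_congr rfl fun v _ => ?_
  rw [← add_smul, Pi.sub_apply, Nat.sub_add_cancel (h v)]

lemma sum_add_smul (V : VAS d) (m g : (Fin d → ℤ) → ℕ) :
    ∑ v ∈ V, (m + g) v • v = ∑ v ∈ V, m v • v + ∑ v ∈ V, g v • v := by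
  simp only [Pi.add_apply, add_smul, Finset.sum_add_distrib]

/-- If `V` has a nonzero nonnegative vector `u`, then every deep nonnegative integer combination `t` of `V`
is box-reachable. The frequently used vectors either contain a launching pair, or contain `a` and `b`
as in `launches_or_spanning`; in the latter case a positive multiple of `u` is a positive
combination of `a` and `b`, and trading copies of `a` and `b` for copies of `u` makes `u` frequent
without changing `t`. -/
lemma mem_boxReach_of_combination {V : VAS 2} {M A B K : ℕ} (hM : ∀ w ∈ V, vecNorm w ≤ M)
    (hB : 2 * V.card * M ≤ B) (hA : 2 * V.card * M + B * M ≤ A)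
    (hK : 8 * A * M ^ 2 + 2 * A + 2 * B ≤ K)
    {u : Fin 2 → ℤ} (hu : u ∈ V) (hu0 : 0 ≤ u) (hu1 : u ≠ 0)
    {m : (Fin 2 → ℤ) → ℕ} {t : Fin 2 → ℕ} (ht : toInt t = ∑ w ∈ V, m w • w)
    (hdeep : ∀ k, 2 * (A + B) * M ≤ t k) (hdeep' : ∀ k, V.card * K * M < t k) :
    t ∈ boxReach V := by
  have hpos : ∀ k, 0 < ∑ w ∈ V with K ≤ m w, (m w : ℤ) * w k := fun k => by
    refine sum_frequent_pos hM m ?_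
    have := hdeep' k
    rw [← ht, toInt]
    exact_mod_cast this
  rcases launches_or_spanning hpos with ⟨x, hx, v, hv, h⟩ | ⟨a, ha, b, hb, a0, a1, b0, b1, hD⟩
  · rw [Finset.mem_filter] at hx hv
    have hg : Pi.single x (2 * A) + Pi.single v (2 * B) ≤ m := fun w => by
      simp only [Pi.add_apply, Pi.single_apply]
      split_ifs with h1 h2 h2
      · subst h1; omega
      · subst h1; omega
      · subst h2; omega
      · omega
    refine mem_boxReach_of_launches hM (m - (Pi.single x (2 * A) + Pi.single v (2 * B)))
      hx.1 hv.1 h hB hA ?_ hdeep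
    rw [sum_sub_smul V hg, ← ht, sum_add_smul, sum_single_smul hx.1, sum_single_smul hv.1,
      smul_add, mul_smul, mul_smul]
    abel
  · rw [Finset.mem_filter] at ha hb
    obtain ⟨v, hv, h⟩ : ∃ v, (v ∈ V ∧ K ≤ m v) ∧ Launches u v := by
      rcases (hu0 0).lt_or_eq with h0 | h0
      · exact ⟨b, hb, hu0, Fin.forall_fin_two.2 ⟨Or.inl h0, Or.inr b1⟩⟩
      · have h1 : 0 < u 1 := (hu0 1).lt_of_ne fun h1 => hu1 <| by
          ext k
          fin_cases k
          exacts [h0.symm, h1.symm]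
        exact ⟨a, ha, hu0, Fin.forall_fin_two.2 ⟨Or.inr a0, Or.inl h1⟩⟩
    have bound : ∀ w ∈ V, ∀ k, |w k| ≤ M := fun w hw k =>
      (abs_apply_le_vecNorm w k).trans (by exact_mod_cast hM w hw)
    have detbound : ∀ w ∈ V, ∀ z ∈ V, w 0 * z 1 - w 1 * z 0 ≤ 2 * M ^ 2 := fun w hw z hz => by
      have h1 : |w 0 * z 1| ≤ M * M := by
        rw [abs_mul]
        exact mul_le_mul (bound w hw 0) (bound z hz 1) (abs_nonneg _) (by positivity)
      have h2 : |w 1 * z 0| ≤ M * M := by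
        rw [abs_mul]
        exact mul_le_mul (bound w hw 1) (bound z hz 0) (abs_nonneg _) (by positivity)
      linarith [(abs_le.1 h1).2, (abs_le.1 h2).1]
    have u0 : 0 ≤ u 0 := hu0 0
    have u1 : 0 ≤ u 1 := hu0 1
    -- Cramer's rule, with `D + 1 = det (a, b)`: `p • a + q • b = (D + 1) • u`.
    obtain ⟨p, hp⟩ := Int.eq_ofNat_of_zero_le
      (show 0 ≤ u 0 * b 1 - u 1 * b 0 by nlinarith)
    obtain ⟨q, hq⟩ := Int.eq_ofNat_of_zero_le
      (show 0 ≤ a 0 * u 1 - a 1 * u 0 by nlinarith)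
    obtain ⟨D, hD'⟩ := Int.eq_succ_of_zero_lt hD
    have hple : p ≤ 2 * M ^ 2 := by
      have := detbound u hu b hb.1
      rw [hp] at this
      exact_mod_cast this
    have hqle : q ≤ 2 * M ^ 2 := by
      have := detbound a ha.1 u hu
      rw [hq] at this
      exact_mod_cast this
    have cramer : p • a + q • b = D • u + u := by
      ext k
      simp only [Pi.add_apply, nsmul_apply_eq, ← hp, ← hq]
      have hD'' : (D : ℤ) = a 0 * b 1 - a 1 * b 0 - 1 := by rw [hD']; ring
      rw [hD'']
      fin_cases k <;> simp <;> ring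
    have hbudget : 2 * A * p + 2 * A * q + 2 * B ≤ K := by
      have h1 : 2 * A * p ≤ 2 * A * (2 * M ^ 2) := Nat.mul_le_mul_left _ hple
      have h2 : 2 * A * q ≤ 2 * A * (2 * M ^ 2) := Nat.mul_le_mul_left _ hqle
      linarith
    have hg : Pi.single a (2 * A * p) + Pi.single b (2 * A * q) + Pi.single v (2 * B) ≤ m :=
      fun w => by
        rcases le_or_gt K (m w) with hw | hw
        · refine le_trans ?_ (hbudget.trans hw)
          simp only [Pi.add_apply, Pi.single_apply]
          split_ifs <;> omega
        · have hwa : w ≠ a := fun e => by subst e; omega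
          have hwb : w ≠ b := fun e => by subst e; omega
          have hwv : w ≠ v := fun e => by subst e; omega
          simp [hwa, hwb, hwv]
    refine mem_boxReach_of_launches hM
      (m - (Pi.single a (2 * A * p) + Pi.single b (2 * A * q) + Pi.single v (2 * B))
        + Pi.single u (2 * A * D)) hu hv.1 h hB hA ?_ hdeep
    have key : (2 * A * p) • a + (2 * A * q) • b = (2 * A * D) • u + 2 • A • u := by
      rw [mul_smul _ p, mul_smul _ q, ← smul_add, cramer, smul_add, smul_smul, smul_smul]
    rw [sum_add_smul, sum_sub_smul V hg, ← ht, sum_add_smul, sum_add_smul, sum_single_smul ha.1,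
      sum_single_smul hb.1, sum_single_smul hv.1, sum_single_smul hu, key, smul_add, mul_smul 2 B v]
    abel

/-! ### The threshold and its computability -/

/-- The largest norm of a vector of `V`. -/
def maxNorm (V : VAS d) : ℕ := V.sup vecNorm

lemma maxNorm_le_norm (V : VAS 2) : maxNorm V ≤ norm V := by
  refine Finset.sup_le fun v hv => ?_
  have : vecNorm v ≤ ∑ v ∈ V, vecNorm v :=
    Finset.single_le_sum (f := vecNorm) (fun _ _ => Nat.zero_le _) hv
  unfold norm
  omega

lemma maxNorm_toFinset (l : List (Fin 2 → ℤ)) :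
    maxNorm l.toFinset = l.foldr (fun v n => max (max (v 0).natAbs (v 1).natAbs) n) 0 := by
  induction l with
  | nil => rfl
  | cons v l ih =>
    have hv : vecNorm v = max (v 0).natAbs (v 1).natAbs := by
      simp [vecNorm, Fin.univ_succ]
    rw [List.toFinset_cons, maxNorm, Finset.sup_insert, List.foldr_cons, ← ih, hv]
    rfl

/-- The encoding of the integers lists `0, -1, 1, -2, 2, …`, so `|z|` is half the code of `z`,
rounded up. -/
lemma primrec_natAbs : Primrec Int.natAbs := by
  have e : ∀ z : ℤ, z.natAbs = (Encodable.encode z + 1) / 2 := by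
    intro z
    cases z with
    | ofNat n =>
      have : Encodable.encode (Int.ofNat n) = 2 * n := rfl
      rw [this]
      simp
      omega
    | negSucc n =>
      have : Encodable.encode (Int.negSucc n) = 2 * n + 1 := rfl
      rw [this, Int.natAbs_negSucc]
      omega
  exact (Primrec.nat_div.comp (Primrec.succ.comp Primrec.encode) (Primrec.const 2)).of_eq
    fun z => (e z).symm

lemma primrec_maxNorm : Primrec fun l : List (Fin 2 → ℤ) => maxNorm l.toFinset := by
  have happ : ∀ k : Fin 2, Primrec fun x : List (Fin 2 → ℤ) × (Fin 2 → ℤ) × ℕ =>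
      (x.2.1 k).natAbs := fun k =>
    primrec_natAbs.comp (Primrec.fin_app.comp (Primrec.fst.comp Primrec.snd) (Primrec.const k))
  have hstep : Primrec fun x : List (Fin 2 → ℤ) × (Fin 2 → ℤ) × ℕ =>
      max (max (x.2.1 0).natAbs (x.2.1 1).natAbs) x.2.2 :=
    Primrec.nat_max.comp (Primrec.nat_max.comp (happ 0) (happ 1))
      (Primrec.snd.comp Primrec.snd)
  exact (Primrec.list_foldr Primrec.id (Primrec.const 0) hstep.to₂).of_eq fun l =>
    (maxNorm_toFinset l).symm

/-- The depth from which on reachability and box-reachability agree. The exponent is generous: with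
`X = maxNorm V + 1`, the lemma `mem_boxReach_of_combination` is applied with `A = 8 * X ^ 4`,
`B = 8 * X ^ 3` and `K = 96 * X ^ 6`, and `V` has at most `4 * X ^ 2` vectors. -/
def threshold (V : VAS 2) : ℕ := 512 * (maxNorm V + 1) ^ 9

lemma effectivelyComputable_threshold : EffectivelyComputable threshold := by
  have hpow : ∀ j : ℕ, Primrec fun n : ℕ => (n + 1) ^ j := by
    intro j
    induction j with
    | zero => exact (Primrec.const 1).of_eq fun n => (pow_zero _).symm
    | succ j ih => exact (Primrec.nat_mul.comp ih Primrec.succ).of_eq fun n => (pow_succ _ _).symm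
  exact (Primrec.nat_mul.comp (Primrec.const 512) ((hpow 9).comp primrec_maxNorm)).to_comp

lemma mem_boxReach_of_mem_reach {V : VAS 2} {t : Fin 2 → ℕ} (ht : t ∈ reach V)
    (hdeep : t ∈ deep 2 (threshold V)) : t ∈ boxReach V := by
  obtain ⟨π, hπ, hrun⟩ := ht
  set M := maxNorm V with hMdef
  have hM : ∀ w ∈ V, vecNorm w ≤ M := fun w hw => Finset.le_sup (f := vecNorm) hw
  have hdeep : ∀ k, 512 * (M + 1) ^ 9 ≤ t k := hdeep
  have ht0 : toInt t ≠ 0 := fun h => by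
    have h1 : (t 0 : ℤ) = 0 := congrFun h 0
    have h2 := hdeep 0
    have h3 : 0 < (M + 1) ^ 9 := by positivity
    omega
  obtain ⟨u, hu, hu0, hu1⟩ := exists_nonneg_of_nRun hrun ht0
  have hcard : V.card ≤ 4 * (M + 1) ^ 2 := (card_le_of_vecNorm_le hM).trans (by nlinarith)
  have hsum : toInt t = ∑ w ∈ V, π.count w • w := by
    rw [← eff_eq_sum_count hπ, ← hrun.1, zero_add]
  have hcM : V.card * M ≤ 4 * (M + 1) ^ 3 := by
    calc V.card * M ≤ 4 * (M + 1) ^ 2 * (M + 1) := Nat.mul_le_mul hcard (Nat.le_succ M)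
      _ = 4 * (M + 1) ^ 3 := by ring
  have hpow : ∀ {i j : ℕ}, i ≤ j → (M + 1) ^ i ≤ (M + 1) ^ j := fun h =>
    Nat.pow_le_pow_right (Nat.succ_pos M) h
  refine mem_boxReach_of_combination (A := 8 * (M + 1) ^ 4) (B := 8 * (M + 1) ^ 3)
    (K := 96 * (M + 1) ^ 6) hM (by linarith) ?_ ?_ (hπ u hu) hu0 hu1 hsum
    (fun k => le_trans ?_ (hdeep k)) (fun k => lt_of_lt_of_le ?_ (hdeep k))
  · have : 8 * (M + 1) ^ 4 = 8 * (M + 1) ^ 3 + 8 * (M + 1) ^ 3 * M := by ring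
    linarith
  · have h1 : M ^ 2 ≤ (M + 1) ^ 2 := Nat.pow_le_pow_left (Nat.le_succ M) 2
    have h2 : 8 * (8 * (M + 1) ^ 4) * M ^ 2 ≤ 64 * (M + 1) ^ 6 :=
      (Nat.mul_le_mul_left _ h1).trans (le_of_eq (by ring))
    have h3 := hpow (show 4 ≤ 6 by norm_num)
    have h4 := hpow (show 3 ≤ 6 by norm_num)
    linarith
  · have h3 := hpow (show 3 ≤ 4 by norm_num)
    calc 2 * (8 * (M + 1) ^ 4 + 8 * (M + 1) ^ 3) * M
        ≤ 2 * (8 * (M + 1) ^ 4 + 8 * (M + 1) ^ 4) * (M + 1) :=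
          Nat.mul_le_mul (by linarith) (Nat.le_succ M)
      _ = 32 * (M + 1) ^ 5 := by ring
      _ ≤ 512 * (M + 1) ^ 9 := Nat.mul_le_mul (by norm_num) (hpow (by norm_num))
  · calc V.card * (96 * (M + 1) ^ 6) * M = V.card * M * (96 * (M + 1) ^ 6) := by ring
      _ ≤ 4 * (M + 1) ^ 3 * (96 * (M + 1) ^ 6) := Nat.mul_le_mul_right _ hcM
      _ = 384 * (M + 1) ^ 9 := by ring
      _ < 512 * (M + 1) ^ 9 := Nat.mul_lt_mul_of_pos_right (by norm_num) (by positivity)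

end VAS

theorem theorem1 :
    ∃ W : VAS 2 → ℕ,
      VAS.EffectivelyComputable W ∧
      (∃ p : Polynomial ℕ, ∀ V : VAS 2, W V ≤ p.eval (VAS.norm V)) ∧
      ∀ V : VAS 2,
        VAS.boxReach V ∩ VAS.deep 2 (W V) = VAS.reach V ∩ VAS.deep 2 (W V) := by
  refine ⟨VAS.threshold, VAS.effectivelyComputable_threshold,
    ⟨Polynomial.C 512 * (Polynomial.X + 1) ^ 9, fun V => ?_⟩, fun V => ?_⟩
  · simp only [Polynomial.eval_mul, Polynomial.eval_C, Polynomial.eval_pow, Polynomial.eval_add,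
      Polynomial.eval_X, Polynomial.eval_one]
    have := VAS.maxNorm_le_norm V
    unfold VAS.threshold
    gcongr
  · ext t
    exact ⟨fun ⟨⟨π, hπ, hrun, _⟩, hdeep⟩ => ⟨⟨π, hπ, hrun⟩, hdeep⟩,
      fun ⟨hreach, hdeep⟩ => ⟨VAS.mem_boxReach_of_mem_reach hreach hdeep, hdeep⟩⟩
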